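/- Let $X$ be a non-empty completely regular Hausdorff space, $C(X)$ the ring of continuous real-valued functions on $X$, $\beta X$ the Stone–Čech compactification of $X$ (with $X\subseteq\beta X$), $I(X)$ the set of isolated points of $X$, and $X_L$ the set of points of $X$ that have a compact neighbourhood. For $f\in C(X)$ put $Z(f)=\{x\in X: f(x)=0\}$. For $A\subseteq\beta X$ let $O^A$ be the set of all $f\in C(X)$ with $A\subseteq \operatorname{int}_{\beta X}\operatorname{cl}_{\beta X}Z(f)$. Let $C_F(X)$ be the socle of $C(X)$, that is, the sum of all minimal ideals of $C(X)$, and let $C_K(X)$ be the ideal of all $f\in C(X)$ for which the support $\overline{X\setminus Z(f)}$ is compact. A non-zero ideal is called essential if it intersects every non-zero ideal non-trivially. An ideal $J$ is called pure if for every $f\in J$ there is $g\in J$ with $f=fg$. The intersection of the empty family of ideals is $C(X)$. (i) The intersection of all essential minimal prime ideals of $C(X)$ is equal to $C_F(X)$. Moreover, $$C_F(X)=O^{\beta X\setminus I(X)}=\{f\in C(X): X\setminus Z(f)\text{ is finite}\}.$$ (ii) Every intersection of essential minimal prime ideals of $C(X)$ is an essential ideal if and only if $I(X)$ is dense in $X$.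 (iii) The following are equivalent: (a) the intersection of all essential minimal prime ideals of $C(X)$ is equal to $C_K(X)$; (b) $I(X)=X_L=\bigcup_{f\in C_K(X)}\overline{X\setminus Z(f)}$; (c) $I(X)=X_L$ and $C_K(X)$ is a pure ideal. -/

import Mathlib

open Topology

namespace RingCX

section Ring

variable {R : Type*} [CommRing R]

/-- A non-zero ideal is essential if it meets every non-zero ideal non-trivially. -/
def IsEssential (I : Ideal R) : Prop :=
  I ≠ ⊥ ∧ ∀ J : Ideal R, J ≠ ⊥ → I ⊓ J ≠ ⊥

/-- An ideal `I` is pure if every `f ∈ I` satisfies `f = f * g` for some `g ∈ I`. -/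
def IsPure (I : Ideal R) : Prop :=
  ∀ f ∈ I, ∃ g ∈ I, f = f * g

variable (R) in
/-- The set of essential minimal prime ideals of `R`. -/
def essentialMinimalPrimes : Set (Ideal R) :=
  {P | P ∈ minimalPrimes R ∧ IsEssential P}

variable (R) in
/-- The socle of `R`: the sum of all minimal (non-zero) ideals. -/
def socle : Ideal R :=
  sSup {I : Ideal R | IsAtom I}

end Ring

section Space

variable (X : Type*) [TopologicalSpace X]

/-- `I(X)`: the set of isolated points of `X`. -/
def isolatedPoints : Set X :=
  {x | IsOpen ({x} : Set X)}

/-- `X_L`: the set of points of `X` that have a compact neighbourhood. -/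
def locallyCompactPoints : Set X :=
  {x | ∃ K ∈ 𝓝 x, IsCompact K}

variable {X} in
/-- `Z(f)`: the zero set of `f`. -/
def zeroSet (f : C(X, ℝ)) : Set X :=
  {x | f x = 0}

variable {X} in
/-- `O^A` for `A ⊆ βX`: all `f` such that every `p ∈ A` lies in the interior, taken in `βX`,
of the closure in `βX` of the zero set of `f`. -/
def oIdeal (A : Set (StoneCech X)) : Set C(X, ℝ) :=
  {f | ∀ p ∈ A, p ∈ interior (closure ((stoneCechUnit : X → StoneCech X) '' zeroSet f))}

/-- The complement in `βX` of the set of isolated points of `X`, with `X` regarded as a subset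
of `βX`. -/
def betaMinusIsolated : Set (StoneCech X) :=
  ((stoneCechUnit : X → StoneCech X) '' isolatedPoints X)ᶜ

/-- `C_K(X)`: the ideal of functions with compact support. -/
def compactSupportIdeal : Ideal C(X, ℝ) where
  carrier := {f | IsCompact (closure (zeroSet f)ᶜ)}
  zero_mem' := by simp [zeroSet]
  add_mem' {f g} hf hg := by
    have h : closure (zeroSet (f + g))ᶜ ⊆ closure (zeroSet f)ᶜ ∪ closure (zeroSet g)ᶜ := by
      rw [← closure_union]
      refine closure_mono fun x hx => ?_
      by_contra hc
      simp only [zeroSet, Set.mem_union, Set.mem_compl_iff, Set.mem_ofPred_eq, not_or,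
        not_not, ContinuousMap.add_apply] at hx hc
      exact hx (by rw [hc.1, hc.2, add_zero])
    exact (hf.union hg).of_isClosed_subset isClosed_closure h
  smul_mem' c f hf := by
    refine IsCompact.of_isClosed_subset hf isClosed_closure (closure_mono fun x hx h => hx ?_)
    have h0 : f x = 0 := h
    simp [zeroSet, h0]

end Space

end RingCX

namespace RingCX

/-! ### Functions with finite cozero set, bumps and point indicators -/

section Functions

variable {X : Type*} [TopologicalSpace X]

/-! Everything is compared with the ideal `F` of functions with finite cozero set, which is
generated by the indicators of isolated points. A prime is essential exactly when it contains `F`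
(`isEssential_of_finiteCozeroIdeal_le`, `finiteCozeroIdeal_le_of_isEssential`), and any `f` outside
`F` is avoided by some minimal prime containing `F` (`exists_essentialMinimalPrime_notMem`); hence
the intersection in question is `F`. The socle and the `O`-ideal are identified with `F` separately.
The rest concerns `F` alone: it is essential iff isolated points are dense, and it equals `C_K` iff
supports of functions in `C_K` consist of isolated points, since a compact set of isolated points is
finite. -/

theorem mem_compl_zeroSet {f : C(X, ℝ)} {x : X} : x ∈ (zeroSet f)ᶜ ↔ f x ≠ 0 := Iff.rfl

theorem isClosed_zeroSet (f : C(X, ℝ)) : IsClosed (zeroSet f) :=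
  isClosed_eq f.continuous continuous_const

theorem isOpen_compl_zeroSet (f : C(X, ℝ)) : IsOpen (zeroSet f)ᶜ :=
  (isClosed_zeroSet f).isOpen_compl

theorem mem_compactSupportIdeal {f : C(X, ℝ)} :
    f ∈ compactSupportIdeal X ↔ IsCompact (closure (zeroSet f)ᶜ) := Iff.rfl

variable (X) in
/-- The ideal of functions with finite cozero set. -/
def finiteCozeroIdeal : Ideal C(X, ℝ) where
  carrier := {f | (zeroSet f)ᶜ.Finite}
  zero_mem' := by simp [zeroSet]
  add_mem' {f g} hf hg := by
    refine (Set.Finite.union hf hg).subset fun x hx => ?_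
    by_contra hc
    rw [Set.mem_union, not_or, mem_compl_zeroSet, mem_compl_zeroSet, not_not, not_not] at hc
    exact hx (show f x + g x = 0 by rw [hc.1, hc.2, add_zero])
  smul_mem' c f hf := by
    refine Set.Finite.subset hf fun x hx h => hx ?_
    have h0 : f x = 0 := h
    simp [zeroSet, h0]

theorem mem_finiteCozeroIdeal {f : C(X, ℝ)} :
    f ∈ finiteCozeroIdeal X ↔ (zeroSet f)ᶜ.Finite := Iff.rfl

theorem exists_bump [CompletelyRegularSpace X] {U : Set X} (hU : IsOpen U) {x : X} (hx : x ∈ U) :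
    ∃ f : C(X, ℝ), f x = 1 ∧ ∀ y ∉ U, f y = 0 := by
  obtain ⟨f, hf, h0, h1⟩ := CompletelyRegularSpace.completely_regular x Uᶜ hU.isClosed_compl
    (fun h => h hx)
  refine ⟨⟨fun y => 1 - (f y : ℝ), by fun_prop⟩, by simp [h0], fun y hy => ?_⟩
  simp [h1 (show y ∈ Uᶜ from hy)]

theorem exists_point_indicator [CompletelyRegularSpace X] {x : X} (hx : x ∈ isolatedPoints X) :
    ∃ e : C(X, ℝ), e x = 1 ∧ ∀ y ≠ x, e y = 0 :=
  exists_bump (U := {x}) hx rfl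

theorem isolated_of_finite_open [T1Space X] {U : Set X} (hU : IsOpen U) (hf : U.Finite) {x : X}
    (hx : x ∈ U) : x ∈ isolatedPoints X := by
  have h : ({x} : Set X) = U ∩ (U \ {x})ᶜ := by
    ext y
    by_cases hy : y = x <;> simp [hy, hx]
  change IsOpen {x}
  rw [h]
  exact hU.inter (hf.subset Set.sdiff_subset).isClosed.isOpen_compl

theorem cozero_subset_isolatedPoints [T1Space X] {f : C(X, ℝ)} (hf : f ∈ finiteCozeroIdeal X) :
    (zeroSet f)ᶜ ⊆ isolatedPoints X :=
  fun _ hx => isolated_of_finite_open (isOpen_compl_zeroSet f) hf hx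

theorem finite_of_isCompact_subset_isolatedPoints {K : Set X} (hK : IsCompact K)
    (h : K ⊆ isolatedPoints X) : K.Finite := by
  refine hK.finite (isDiscrete_iff_forall_mem_exists_isOpen.2 fun x hx => ⟨{x}, h hx, ?_⟩)
  simpa using hx

theorem point_indicator_mem {x : X} {e : C(X, ℝ)} (he : ∀ y ≠ x, e y = 0) :
    e ∈ finiteCozeroIdeal X :=
  (Set.finite_singleton x).subset fun y hy => by
    by_contra h
    exact hy (he y h)

/-- The cozero set is finite and open, so its points are isolated and `f` is the finite sum of the
products `f * e x`. -/
theorem mem_of_point_indicators_mem [T35Space X] {I : Ideal C(X, ℝ)} {f : C(X, ℝ)}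
    (hf : f ∈ finiteCozeroIdeal X)
    (h : ∀ x, f x ≠ 0 → ∀ e : C(X, ℝ), e x = 1 → (∀ y ≠ x, e y = 0) → e ∈ I) : f ∈ I := by
  have he : ∀ x : ((zeroSet f)ᶜ : Set X), ∃ e : C(X, ℝ), e x = 1 ∧ ∀ y ≠ x.1, e y = 0 := fun x =>
    exists_point_indicator (cozero_subset_isolatedPoints hf x.2)
  choose e he1 he0 using he
  have : Fintype ((zeroSet f)ᶜ : Set X) := Set.Finite.fintype hf
  have key : f = ∑ x : ((zeroSet f)ᶜ : Set X), f * e x := by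
    ext y
    rw [ContinuousMap.sum_apply]
    by_cases hy : f y = 0
    · simp [hy]
    · rw [Finset.sum_eq_single (⟨y, hy⟩ : ((zeroSet f)ᶜ : Set X))]
      · simp [he1 ⟨y, hy⟩]
      · intro z _ hz
        have : y ≠ z.1 := fun h => hz (Subtype.ext h.symm)
        simp [he0 z y this]
      · simp
  rw [key]
  exact I.sum_mem fun x _ => I.mul_mem_left _ (h x x.2 _ (he1 x) (he0 x))

theorem finiteCozeroIdeal_le_compactSupportIdeal [T1Space X] :
    finiteCozeroIdeal X ≤ compactSupportIdeal X := by
  intro f hf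
  rw [mem_compactSupportIdeal, (mem_finiteCozeroIdeal.1 hf).isClosed.closure_eq]
  exact (mem_finiteCozeroIdeal.1 hf).isCompact

theorem isolatedPoints_subset_locallyCompactPoints :
    isolatedPoints X ⊆ locallyCompactPoints X :=
  fun x hx => ⟨{x}, IsOpen.mem_nhds hx rfl, isCompact_singleton⟩

/-- An ideal containing a nonzero multiple of a point indicator contains the indicator. -/
theorem point_indicator_mem_of_mul_mem {J : Ideal C(X, ℝ)} {x : X} {e c : C(X, ℝ)}
    (he1 : e x = 1) (he0 : ∀ y ≠ x, e y = 0) (h : e * c ∈ J) (h0 : e * c ≠ 0) : e ∈ J := by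
  have hc : c x ≠ 0 := by
    intro hc
    refine h0 (ContinuousMap.ext fun y => ?_)
    by_cases hy : y = x
    · simp [hy, hc]
    · simp [he0 y hy]
  have : e = ContinuousMap.const X (c x)⁻¹ * (e * c) := by
    ext y
    by_cases hy : y = x
    · simp [hy, hc, he1]
    · simp [he0 y hy]
  rw [this]
  exact J.mul_mem_left _ h

theorem isAtom_span_point_indicator {x : X} {e : C(X, ℝ)} (he1 : e x = 1)
    (he0 : ∀ y ≠ x, e y = 0) : IsAtom (Ideal.span {e}) := by
  refine ⟨fun h => ?_, fun J hJ => ?_⟩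
  · rw [Ideal.span_singleton_eq_bot] at h
    simp [h] at he1
  · by_contra hne
    obtain ⟨g, hg, hg0⟩ := J.ne_bot_iff.1 hne
    refine hJ.not_ge ?_
    rw [Ideal.span_singleton_le_iff_mem]
    obtain ⟨c, rfl⟩ := Ideal.mem_span_singleton.1 (hJ.le hg)
    exact point_indicator_mem_of_mul_mem he1 he0 hg hg0

/-- If `f = f * g`, then `g = 1` on the support of `f`, so the cozero set of `g` is a neighbourhood
of it with compact closure. -/
theorem closure_cozero_subset_locallyCompactPoints (h : IsPure (compactSupportIdeal X))
    {f : C(X, ℝ)} (hf : f ∈ compactSupportIdeal X) :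
    closure (zeroSet f)ᶜ ⊆ locallyCompactPoints X := by
  obtain ⟨g, hg, hfg⟩ := h f hf
  have hsub : closure (zeroSet f)ᶜ ⊆ {x | g x = 1} := by
    refine closure_minimal (fun x hx => ?_) (isClosed_eq g.continuous continuous_const)
    have := DFunLike.congr_fun hfg x
    exact (mul_eq_left₀ hx).1 this.symm
  intro x hx
  refine ⟨_, Filter.mem_of_superset ((isOpen_compl_zeroSet g).mem_nhds ?_) subset_closure, hg⟩
  rw [mem_compl_zeroSet, show g x = 1 from hsub hx]
  exact one_ne_zero

end Functions

/-! ### The socle -/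

section Socle

variable {X : Type*} [TopologicalSpace X] [T35Space X]

theorem subsingleton_cozero_of_isAtom {I : Ideal C(X, ℝ)} (hI : IsAtom I) {g : C(X, ℝ)}
    (hg : g ∈ I) : (zeroSet g)ᶜ.Subsingleton := by
  intro x hx y hy
  by_contra hxy
  -- The multiples of `a * g` form a nonzero ideal inside `I` whose members all vanish at `y`,
  -- whereas `g` does not.
  obtain ⟨a, ha1, ha0⟩ := exists_bump (U := {y}ᶜ) isOpen_compl_singleton hxy
  have hle : Ideal.span {a * g} ≤ I :=
    (Ideal.span_singleton_le_iff_mem _).2 (I.mul_mem_left _ hg)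
  rcases hI.le_iff.1 hle with h | h
  · rw [Ideal.span_singleton_eq_bot] at h
    have := DFunLike.congr_fun h x
    simp [ha1] at this
    exact hx this
  · rw [← h] at hg
    obtain ⟨c, hc⟩ := Ideal.mem_span_singleton.1 hg
    have := DFunLike.congr_fun hc y
    simp [ha0 y (by simp)] at this
    exact hy this

theorem socle_eq_finiteCozeroIdeal : socle C(X, ℝ) = finiteCozeroIdeal X := by
  apply le_antisymm
  · exact sSup_le fun I hI g hg => (subsingleton_cozero_of_isAtom hI hg).finite
  · intro f hf
    exact mem_of_point_indicators_mem hf fun x _ e he1 he0 =>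
      (le_sSup (isAtom_span_point_indicator he1 he0) : _ ≤ socle C(X, ℝ))
        (Ideal.mem_span_singleton_self e)

end Socle

/-! ### The `O`-ideal in the Stone–Čech compactification -/

section StoneCech

variable {X : Type*} [TopologicalSpace X] [T35Space X]

/-- By density of `X`, an open set of `βX` with trace `{x}` lies in the closure of that trace, which
is a point. -/
theorem isOpen_singleton_stoneCechUnit {x : X} (hx : x ∈ isolatedPoints X) :
    IsOpen {stoneCechUnit x} := by
  obtain ⟨U, hU, hUx⟩ := (isEmbedding_stoneCechUnit (X := X)).isInducing.isOpen_iff.1 hx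
  have hsub : U ⊆ {stoneCechUnit x} := by
    refine (denseRange_stoneCechUnit.open_subset_closure_inter hU).trans
      (closure_minimal ?_ isClosed_singleton)
    rintro _ ⟨hy, z, rfl⟩
    have : z ∈ ({x} : Set X) := hUx ▸ hy
    rw [Set.mem_singleton_iff.1 this]
    rfl
  have hmem : x ∈ stoneCechUnit ⁻¹' U := hUx ▸ rfl
  rwa [← hsub.antisymm (Set.singleton_subset_iff.2 hmem)]

theorem stoneCechUnit_mem_closure_image_iff {Z : Set X} (hZ : IsClosed Z) {x : X} :
    stoneCechUnit x ∈ closure ((stoneCechUnit : X → StoneCech X) '' Z) ↔ x ∈ Z := by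
  have := (isEmbedding_stoneCechUnit (X := X)).closure_eq_preimage_closure_image Z
  rw [hZ.closure_eq] at this
  exact (Set.ext_iff.1 this x).symm

theorem oIdeal_betaMinusIsolated :
    oIdeal (betaMinusIsolated X) = (finiteCozeroIdeal X : Set C(X, ℝ)) := by
  ext f
  constructor
  · intro hf
    let K := (interior (closure ((stoneCechUnit : X → StoneCech X) '' zeroSet f)))ᶜ
    have hK : IsCompact K := isOpen_interior.isClosed_compl.isCompact
    have hKi : K ⊆ isolatedPoints (StoneCech X) := by
      intro p hp
      have : p ∈ stoneCechUnit '' isolatedPoints X := by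
        by_contra h
        exact hp (hf p h)
      obtain ⟨x, hx, rfl⟩ := this
      exact isOpen_singleton_stoneCechUnit hx
    refine ((finite_of_isCompact_subset_isolatedPoints hK hKi).preimage
      (isEmbedding_stoneCechUnit (X := X)).injective.injOn).subset fun x hx h => hx ?_
    exact (stoneCechUnit_mem_closure_image_iff (isClosed_zeroSet f)).1 (interior_subset h)
  · intro hf p hp
    have hfin : ((stoneCechUnit : X → StoneCech X) '' (zeroSet f)ᶜ).Finite :=
      Set.Finite.image _ hf
    refine mem_interior.2 ⟨_, fun q hq => ?_, hfin.isClosed.isOpen_compl, fun h => hp ?_⟩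
    · have : q ∈ closure (Set.range (stoneCechUnit : X → StoneCech X)) :=
        denseRange_stoneCechUnit q
      rw [← Set.image_univ, ← Set.union_compl_self (zeroSet f), Set.image_union, closure_union,
        hfin.isClosed.closure_eq] at this
      exact this.resolve_right hq
    · exact Set.image_mono (cozero_subset_isolatedPoints hf) h

end StoneCech

/-! ### Essential minimal primes -/

section MinimalPrimes

/-- In a reduced ring, a prime ideal which misses a nonzero ideal is an annihilator. -/
theorem mem_iff_mul_eq_zero_of_inf_eq_bot {R : Type*} [CommRing R] {P J : Ideal R} [P.IsPrime]
    (h : P ⊓ J = ⊥) {g : R} (hg : g ∈ J) (hg0 : g ≠ 0) {a : R} : a ∈ P ↔ a * g = 0 := by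
  constructor
  · intro ha
    have : a * g ∈ P ⊓ J := ⟨P.mul_mem_right _ ha, J.mul_mem_left _ hg⟩
    rwa [h] at this
  · intro ha
    have hgP : g ∉ P := fun hgP => hg0 (by
      have : g ∈ P ⊓ J := ⟨hgP, hg⟩
      rwa [h] at this)
    exact (Ideal.IsPrime.mem_or_mem ‹_› (ha ▸ P.zero_mem : a * g ∈ P)).resolve_right hgP

variable {X : Type*} [TopologicalSpace X] [T35Space X]

/-- Here `P` is the annihilator of some `g ≠ 0`. Two disjoint bumps at distinct points of the cozero
set of `g` would have product zero with neither in `P`, so that set is a single point; then `g ∈ P`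
would give `g * g = 0`. -/
theorem not_finiteCozeroIdeal_le_of_inf_eq_bot {P J : Ideal C(X, ℝ)} [P.IsPrime] (hJ : J ≠ ⊥)
    (h : P ⊓ J = ⊥) : ¬ finiteCozeroIdeal X ≤ P := by
  intro hle
  obtain ⟨g, hg, hg0⟩ := J.ne_bot_iff.1 hJ
  have hP : ∀ a, a ∈ P ↔ a * g = 0 := fun a => mem_iff_mul_eq_zero_of_inf_eq_bot h hg hg0
  have hsub : (zeroSet g)ᶜ.Subsingleton := by
    intro x hx y hy
    by_contra hxy
    obtain ⟨U, V, hU, hV, hxU, hyV, hUV⟩ := t2_separation hxy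
    obtain ⟨a, ha1, ha0⟩ := exists_bump hU hxU
    obtain ⟨b, hb1, hb0⟩ := exists_bump hV hyV
    have hab : a * b = 0 := by
      ext z
      by_cases hz : z ∈ U
      · simp [hb0 z (Set.disjoint_left.1 hUV hz)]
      · simp [ha0 z hz]
    rcases Ideal.IsPrime.mem_or_mem ‹_› (hab ▸ P.zero_mem : a * b ∈ P) with h | h
    · have := DFunLike.congr_fun ((hP a).1 h) x
      simp [ha1] at this
      exact hx this
    · have := DFunLike.congr_fun ((hP b).1 h) y
      simp [hb1] at this
      exact hy this
  have hgP := (hP g).1 (hle (show g ∈ finiteCozeroIdeal X from hsub.finite))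
  refine hg0 (ContinuousMap.ext fun x => mul_self_eq_zero.1 ?_)
  exact DFunLike.congr_fun hgP x

theorem isEssential_of_finiteCozeroIdeal_le [Nonempty X] {P : Ideal C(X, ℝ)} [P.IsPrime]
    (hle : finiteCozeroIdeal X ≤ P) : IsEssential P := by
  refine ⟨?_, fun J hJ h => not_finiteCozeroIdeal_le_of_inf_eq_bot hJ h hle⟩
  rintro rfl
  exact not_finiteCozeroIdeal_le_of_inf_eq_bot (J := ⊤) top_ne_bot (bot_inf_eq _) hle

theorem finiteCozeroIdeal_le_of_isEssential {P : Ideal C(X, ℝ)} [P.IsPrime]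
    (hP : IsEssential P) : finiteCozeroIdeal X ≤ P := by
  intro f hf
  refine mem_of_point_indicators_mem hf fun x _ e he1 he0 => ?_
  by_contra he
  refine hP.2 (Ideal.span {e}) (fun h => ?_) ?_
  · rw [Ideal.span_singleton_eq_bot] at h
    simp [h] at he1
  · rw [eq_bot_iff]
    rintro _ ⟨haP, ha⟩
    obtain ⟨c, rfl⟩ := Ideal.mem_span_singleton.1 ha
    by_contra hne
    exact he (point_indicator_mem_of_mul_mem he1 he0 haP hne)

/-- The functions which vanish at most at finitely many points of the cozero set of `f`. -/
def cofiniteSubmonoid (f : C(X, ℝ)) : Submonoid C(X, ℝ) where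
  carrier := {g | ((zeroSet f)ᶜ ∩ zeroSet g).Finite}
  one_mem' := by simp [zeroSet]
  mul_mem' {a b} ha hb := by
    refine (Set.Finite.union ha hb).subset ?_
    rintro x ⟨hx, h⟩
    rcases mul_eq_zero.1 (show a x * b x = 0 from h) with h | h
    exacts [Or.inl ⟨hx, h⟩, Or.inr ⟨hx, h⟩]

theorem exists_essentialMinimalPrime_notMem [Nonempty X] {f : C(X, ℝ)}
    (hf : f ∉ finiteCozeroIdeal X) : ∃ P ∈ essentialMinimalPrimes C(X, ℝ), f ∉ P := by
  have h0 : Disjoint ((⊥ : Ideal C(X, ℝ)) : Set C(X, ℝ)) (cofiniteSubmonoid f) := by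
    rw [Set.disjoint_left]
    rintro _ rfl h
    exact hf (Set.Finite.subset h fun x hx => ⟨hx, rfl⟩)
  obtain ⟨Q, hQ, -, hQd⟩ := Ideal.exists_le_prime_disjoint _ _ h0
  obtain ⟨P, hP, hPQ⟩ := Ideal.exists_minimalPrimes_le (bot_le : ⊥ ≤ Q)
  have hprime : P.IsPrime := hP.1.1
  have hdis : ∀ g ∈ P, g ∉ cofiniteSubmonoid f := fun g hg =>
    Set.disjoint_left.1 hQd (hPQ hg)
  have hle : finiteCozeroIdeal X ≤ P := by
    intro g hg
    refine mem_of_point_indicators_mem hg fun x _ e he1 he0 => ?_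
    -- The indicator `e` is idempotent, and `1 - e` vanishes only at `x`, hence lies in the
    -- submonoid that `P` avoids.
    have hmul : e * (1 - e) ∈ P := by
      convert P.zero_mem
      ext y
      by_cases hy : y = x
      · simp [hy, he1]
      · simp [he0 y hy]
    refine (hprime.mem_or_mem hmul).resolve_right fun h => hdis _ h ?_
    refine (Set.finite_singleton x).subset ?_
    rintro y ⟨-, hy⟩
    by_contra hyx
    have : (1 : ℝ) - e y = 0 := hy
    simp [he0 y hyx] at this
  refine ⟨P, ⟨hP, isEssential_of_finiteCozeroIdeal_le hle⟩, fun h => hdis f h ?_⟩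
  change ((zeroSet f)ᶜ ∩ zeroSet f).Finite
  simp

theorem sInf_essentialMinimalPrimes [Nonempty X] :
    sInf (essentialMinimalPrimes C(X, ℝ)) = finiteCozeroIdeal X := by
  apply le_antisymm
  · intro f hf
    by_contra h
    obtain ⟨P, hP, hfP⟩ := exists_essentialMinimalPrime_notMem h
    exact hfP (sInf_le hP hf)
  · refine le_sInf fun P hP => ?_
    have : P.IsPrime := hP.1.1.1
    exact finiteCozeroIdeal_le_of_isEssential hP.2

end MinimalPrimes

/-! ### Essentiality and density of isolated points -/

section Essential

theorem IsEssential.mono {R : Type*} [CommRing R] {I J : Ideal R} (hI : IsEssential I)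
    (h : I ≤ J) : IsEssential J :=
  ⟨fun hJ => hI.1 (le_bot_iff.1 (hJ ▸ h)), fun K hK hJK =>
    hI.2 K hK (le_bot_iff.1 ((inf_le_inf_right K h).trans hJK.le))⟩

variable {X : Type*} [TopologicalSpace X] [T35Space X]

theorem isEssential_finiteCozeroIdeal_iff [Nonempty X] :
    IsEssential (finiteCozeroIdeal X) ↔ Dense (isolatedPoints X) := by
  constructor
  · intro h
    rw [dense_iff_inter_open]
    rintro U hU ⟨x, hx⟩
    obtain ⟨g, hg1, hg0⟩ := exists_bump hU hx
    have hg : Ideal.span {g} ≠ ⊥ := by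
      intro h
      rw [Ideal.span_singleton_eq_bot] at h
      simp [h] at hg1
    obtain ⟨k, ⟨hkF, hkg⟩, hk0⟩ := (Submodule.ne_bot_iff _).1 (h.2 _ hg)
    obtain ⟨y, hy⟩ := DFunLike.ne_iff.1 hk0
    obtain ⟨c, rfl⟩ := Ideal.mem_span_singleton.1 hkg
    refine ⟨y, ?_, cozero_subset_isolatedPoints hkF hy⟩
    by_contra hyU
    simp [hg0 y hyU] at hy
  · intro h
    have key : ∀ J : Ideal C(X, ℝ), J ≠ ⊥ → finiteCozeroIdeal X ⊓ J ≠ ⊥ := by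
      intro J hJ
      obtain ⟨g, hg, hg0⟩ := J.ne_bot_iff.1 hJ
      obtain ⟨y, hy⟩ := DFunLike.ne_iff.1 hg0
      obtain ⟨x, hxg, hx⟩ := h.inter_open_nonempty _ (isOpen_compl_zeroSet g) ⟨y, hy⟩
      obtain ⟨e, he1, he0⟩ := exists_point_indicator hx
      refine (Submodule.ne_bot_iff _).2 ⟨e * g, ⟨Ideal.mul_mem_right _ _ (point_indicator_mem he0),
        J.mul_mem_left _ hg⟩, fun h0 => hxg ?_⟩
      have := DFunLike.congr_fun h0 x
      simpa [zeroSet, he1] using this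
    refine ⟨fun hb => key ⊤ top_ne_bot ?_, key⟩
    rw [hb, bot_inf_eq]

end Essential

/-! ### Comparison with compactly supported functions -/

section CompactSupport

variable {X : Type*} [TopologicalSpace X] [T35Space X]

theorem finiteCozeroIdeal_eq_compactSupportIdeal_iff :
    finiteCozeroIdeal X = compactSupportIdeal X ↔
      ∀ f ∈ compactSupportIdeal X, closure (zeroSet f)ᶜ ⊆ isolatedPoints X := by
  constructor
  · intro h f hf
    rw [← h] at hf
    rw [(mem_finiteCozeroIdeal.1 hf).isClosed.closure_eq]
    exact cozero_subset_isolatedPoints hf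
  · intro h
    refine le_antisymm finiteCozeroIdeal_le_compactSupportIdeal fun f hf => ?_
    exact (finite_of_isCompact_subset_isolatedPoints hf (h f hf)).subset subset_closure

theorem locallyCompactPoints_subset_iUnion :
    locallyCompactPoints X ⊆ ⋃ f ∈ compactSupportIdeal X, closure (zeroSet f)ᶜ := by
  rintro x ⟨K, hK, hKc⟩
  obtain ⟨g, hg1, hg0⟩ := exists_bump isOpen_interior (mem_interior_iff_mem_nhds.2 hK)
  have hsub : (zeroSet g)ᶜ ⊆ K := fun y hy => by
    by_contra h
    exact hy (hg0 y fun h' => h (interior_subset h'))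
  refine Set.mem_biUnion (x := g) (hKc.of_isClosed_subset isClosed_closure
    (closure_minimal hsub hKc.isClosed)) (subset_closure ?_)
  rw [mem_compl_zeroSet, hg1]
  exact one_ne_zero

theorem isPure_finiteCozeroIdeal : IsPure (finiteCozeroIdeal X) := by
  intro f hf
  have hclopen : IsClopen (zeroSet f)ᶜ :=
    ⟨(mem_finiteCozeroIdeal.1 hf).isClosed, isOpen_compl_zeroSet f⟩
  -- The cozero set, being finite and open, is clopen, so its characteristic function is a
  -- continuous local unit for `f`.
  refine ⟨(LocallyConstant.charFn ℝ hclopen : C(X, ℝ)), ?_, ?_⟩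
  · refine (mem_finiteCozeroIdeal.1 hf).subset fun x hx => ?_
    by_contra h
    exact hx (Set.indicator_of_notMem h _)
  · ext x
    by_cases hx : f x = 0
    · simp [hx]
    · have : LocallyConstant.charFn ℝ hclopen x = 1 :=
        Set.indicator_of_mem (mem_compl_zeroSet.2 hx) _
      simp [this]

theorem isolatedPoints_eq_locallyCompactPoints
    (h : finiteCozeroIdeal X = compactSupportIdeal X) :
    isolatedPoints X = locallyCompactPoints X ∧
      locallyCompactPoints X = ⋃ f ∈ compactSupportIdeal X, closure (zeroSet f)ᶜ := by
  have hU : ⋃ f ∈ compactSupportIdeal X, closure (zeroSet f)ᶜ ⊆ isolatedPoints X :=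
    Set.iUnion₂_subset (finiteCozeroIdeal_eq_compactSupportIdeal_iff.1 h)
  exact ⟨isolatedPoints_subset_locallyCompactPoints.antisymm
      (locallyCompactPoints_subset_iUnion.trans hU),
    locallyCompactPoints_subset_iUnion.antisymm
      (hU.trans isolatedPoints_subset_locallyCompactPoints)⟩

end CompactSupport

end RingCX

theorem theorem3p6 (X : Type*) [TopologicalSpace X] [T35Space X] [Nonempty X] :
    (sInf (RingCX.essentialMinimalPrimes C(X, ℝ)) = RingCX.socle C(X, ℝ) ∧
      (RingCX.socle C(X, ℝ) : Set C(X, ℝ)) = RingCX.oIdeal (RingCX.betaMinusIsolated X) ∧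
      (RingCX.socle C(X, ℝ) : Set C(X, ℝ)) = {f | (RingCX.zeroSet f)ᶜ.Finite}) ∧
    ((∀ S ⊆ RingCX.essentialMinimalPrimes C(X, ℝ), RingCX.IsEssential (sInf S)) ↔
      Dense (RingCX.isolatedPoints X)) ∧
    ((sInf (RingCX.essentialMinimalPrimes C(X, ℝ)) = RingCX.compactSupportIdeal X ↔
        RingCX.isolatedPoints X = RingCX.locallyCompactPoints X ∧
        RingCX.locallyCompactPoints X =
          ⋃ f ∈ RingCX.compactSupportIdeal X, closure (RingCX.zeroSet f)ᶜ) ∧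
      (sInf (RingCX.essentialMinimalPrimes C(X, ℝ)) = RingCX.compactSupportIdeal X ↔
        RingCX.isolatedPoints X = RingCX.locallyCompactPoints X ∧
        RingCX.IsPure (RingCX.compactSupportIdeal X))) := by
  rw [RingCX.sInf_essentialMinimalPrimes, RingCX.socle_eq_finiteCozeroIdeal,
    RingCX.oIdeal_betaMinusIsolated]
  refine ⟨⟨rfl, rfl, rfl⟩, ?_, ?_, ?_⟩
  · rw [← RingCX.isEssential_finiteCozeroIdeal_iff, ← RingCX.sInf_essentialMinimalPrimes]
    -- The full family gives the smallest intersection, and essentiality passes to larger ideals.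
    exact ⟨fun h => h _ subset_rfl, fun h S hS => h.mono (sInf_le_sInf hS)⟩
  · refine ⟨RingCX.isolatedPoints_eq_locallyCompactPoints, fun ⟨h1, h2⟩ => ?_⟩
    refine RingCX.finiteCozeroIdeal_eq_compactSupportIdeal_iff.2 fun f hf => ?_
    rw [h1, h2]
    exact Set.subset_biUnion_of_mem (u := fun f : C(X, ℝ) => closure (RingCX.zeroSet f)ᶜ) hf
  · refine ⟨fun h => ⟨(RingCX.isolatedPoints_eq_locallyCompactPoints h).1,
      h ▸ RingCX.isPure_finiteCozeroIdeal⟩, fun ⟨h1, h2⟩ => ?_⟩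
    refine RingCX.finiteCozeroIdeal_eq_compactSupportIdeal_iff.2 fun f hf => ?_
    rw [h1]
    exact RingCX.closure_cozero_subset_locallyCompactPoints h2 hf
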